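/- **Theorem 3.4.** There are $n$ bidders and $m$ items. Each bidder $i$ has a finite set $T_i\subset\mathbb R_+^{m+1}$ of types $t_i=(\vec v_i,b_i)$ (additive item values $v_{ij}\ge 0$ and a budget $b_i\ge 0$) and a probability distribution $D_i$ on $T_i$; types are independent across bidders. A (randomized) mechanism assigns to every reported profile $t\in\prod_i T_i$ and random seed $r$, drawn independently of the profile, an allocation giving each item to at most one bidder, with $S_i$ the set of items received by bidder $i$, and prices $q_i\in\mathbb R$. Let $\pi_{ij}(t_i)$ and $p_i(t_i)$ be the probability that bidder $i$ gets item $j$ and her expected price when she reports $t_i$, over $t_{-i}\sim\prod_{k\ne i}D_k$ and $r$. Call a mechanism *admissible* if it is BIC, i.e. $\sum_j v_{ij}\pi_{ij}(t_i)-p_i(t_i)\ge \sum_j v_{ij}\pi_{ij}(t_i')-p_i(t_i')$ for all $i$ and $t_i,t_i'\in T_i$, and if for all profiles, seeds and bidders it is ex-post IR ($q_i\le\sum_{j\in S_i}v_{ij}$), ex-post budget respecting ($q_i\le b_i$) and has no positive transfers ($q_i\ge 0$). Call it *optimal* if it is admissible and its expected revenue $\mathbb E[\sum_i q_i]$ under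 truthful reports from $\prod_i D_i$ is maximal among all admissible mechanisms. Then an optimal mechanism exists, and every optimal mechanism $M$ can be implemented as a distribution over virtual welfare maximizers: there is a finitely supported distribution $\Delta$ over tuples of mappings $(f_1^\delta,\dots,f_n^\delta)$, where $f_i^\delta$ maps each type $t_i=(\vec v_i,b_i)\in\mathbb R_+^{m+1}$ to a multiplier $m_i^\delta(t_i)\ge 0$ and a vector $\vec w_i^\delta(t_i)\in\mathbb R^m$, with the following property. Put $$\phi_i^\delta(t_i)(S)=m_i^\delta(t_i)\cdot\min\Big\{b_i,\sum_{j\in S}v_{ij}\Big\}+\sum_{j\in S}w_{ij}^\delta(t_i).$$ Consider the mechanism that samples $\delta\sim\Delta$, on profile $t$ chooses an allocation in $\arg\max_{S_1\sqcup\dots\sqcup S_n\subseteq[m]}\sum_i\phi_i^\delta(t_i)(S_i)$, with ties broken by an arbitrary fixed function of $(\delta,t)$, and charges bidder $i$ the price $\min\{b_i,\sum_{j\in S_i}v_{ij}\}$ if $m_i^\delta(t_i)>0$ and $0$ if $m_i^\delta(t_i)=0$. For every such tie-breaking rule this mechanism is optimal and has the same interim allocation probabilities $\pi_{ij}(t_i)$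 and interim prices $p_i(t_i)$ as $M$. -/

import Mathlib

open MeasureTheory Finset
open scoped NNReal

noncomputable section

namespace BudgetedAuction

/-- A type of a bidder: non-negative values for the `m` items and a non-negative budget,
i.e. a point of `ℝ₊^(m+1)`. -/
@[ext] structure BidderType (m : ℕ) where
  value : Fin m → ℝ≥0
  budget : ℝ≥0

/-- Additive value of a set of items. -/
def BidderType.setValue {m : ℕ} (θ : BidderType m) (S : Finset (Fin m)) : ℝ :=
  ∑ j ∈ S, (θ.value j : ℝ)

/-- An allocation: every item goes to one bidder (`some i`) or to nobody (`none`). -/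
abbrev Allocation (n m : ℕ) := Fin m → Option (Fin n)

/-- The set of items that bidder `i` receives. -/
def bundle {n m : ℕ} (x : Allocation n m) (i : Fin n) : Finset (Fin m) :=
  univ.filter (fun j => x j = some i)

/-- An instance: for every bidder a finite set of types and a distribution on it.
The bidders' types are independent; values and budget of one bidder may be correlated. -/
structure Instance (n m : ℕ) where
  types : Fin n → Finset (BidderType m)
  dist : (i : Fin n) → PMF (types i)

namespace Instance

variable {n m : ℕ} (I : Instance n m)

/-- A profile of (reported) types. -/
abbrev Profile := (i : Fin n) → I.types i

/-- Probability of a type of bidder `i`. -/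
def prob (i : Fin n) (s : I.types i) : ℝ := (I.dist i s).toReal

/-- Probability of a profile. -/
def profileProb (t : I.Profile) : ℝ := ∏ i, I.prob i (t i)

/-- Probability of the types of the bidders other than `i` in the profile `t`. -/
def othersProb (i : Fin n) (t : I.Profile) : ℝ := ∏ k ∈ univ.erase i, I.prob k (t k)

/-- A randomized direct mechanism: the allocation and the prices depend on the reported profile
and on a random seed, which is drawn independently of the profile. -/
structure Mechanism where
  Seed : Type
  [measurableSpace : MeasurableSpace Seed]
  seedLaw : Measure Seed
  [isProbability : IsProbabilityMeasure seedLaw]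
  alloc : I.Profile → Seed → Allocation n m
  price : I.Profile → Seed → Fin n → ℝ
  measurable_alloc : ∀ t i j, MeasurableSet {r | alloc t r j = some i}
  measurable_price : ∀ t i, Measurable (fun r => price t r i)

attribute [instance] Mechanism.measurableSpace Mechanism.isProbability

namespace Mechanism

variable {I} (M : I.Mechanism)

open Classical in
/-- `π_ij(s)`: the probability that bidder `i` receives item `j` when she reports `s`,
over the types of the other bidders and the seed. -/
def interimAlloc (i : Fin n) (j : Fin m) (s : I.types i) : ℝ :=
  ∑ t : I.Profile,
    if t i = s then I.othersProb i t * M.seedLaw.real {r | M.alloc t r j = some i} else 0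

open Classical in
/-- `p_i(s)`: the expected price of bidder `i` when she reports `s`,
over the types of the other bidders and the seed. -/
def interimPrice (i : Fin n) (s : I.types i) : ℝ :=
  ∑ t : I.Profile,
    if t i = s then I.othersProb i t * ∫ r, M.price t r i ∂M.seedLaw else 0

/-- Interim utility of bidder `i` of true type `s` who reports `s'`. -/
def interimUtility (i : Fin n) (s s' : I.types i) : ℝ :=
  ∑ j, (s.1.value j : ℝ) * M.interimAlloc i j s' - M.interimPrice i s'

/-- Bayesian incentive compatibility. -/
def BIC : Prop := ∀ (i : Fin n) (s s' : I.types i), M.interimUtility i s s' ≤ M.interimUtility i s s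

/-- Ex-post individual rationality. -/
def ExPostIR : Prop :=
  ∀ (t : I.Profile) (r : M.Seed) (i : Fin n),
    M.price t r i ≤ (t i).1.setValue (bundle (M.alloc t r) i)

/-- No bidder ever pays more than her budget. -/
def RespectsBudgets : Prop :=
  ∀ (t : I.Profile) (r : M.Seed) (i : Fin n), M.price t r i ≤ ((t i).1.budget : ℝ)

/-- No positive transfers: prices are non-negative. -/
def NoPositiveTransfers : Prop :=
  ∀ (t : I.Profile) (r : M.Seed) (i : Fin n), 0 ≤ M.price t r i

/-- The mechanisms over which the seller optimizes. -/
def Admissible : Prop := M.BIC ∧ M.ExPostIR ∧ M.RespectsBudgets ∧ M.NoPositiveTransfers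

/-- Expected revenue under truthful reports. -/
def revenue : ℝ :=
  ∑ t : I.Profile, I.profileProb t * ∫ r, ∑ i, M.price t r i ∂M.seedLaw

/-- Revenue-optimal among all admissible mechanisms. -/
def IsOptimal : Prop :=
  M.Admissible ∧ ∀ M' : I.Mechanism, M'.Admissible → M'.revenue ≤ M.revenue

end Mechanism

end Instance

/-- A price multiplier `m ≥ 0` and additive virtual values `w_j`, possibly negative. -/
structure VirtualType (m : ℕ) where
  multiplier : ℝ≥0
  w : Fin m → ℝ

/-- A tuple of mappings, one per bidder, from types to multipliers and virtual values. -/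
abbrev VirtualMap (n m : ℕ) := Fin n → BidderType m → VirtualType m

/-- The virtual valuation `S ↦ m · min{b, ∑_{j ∈ S} v_j} + ∑_{j ∈ S} w_j`. -/
def virtualValuation {m : ℕ} (θ : BidderType m) (ψ : VirtualType m) (S : Finset (Fin m)) : ℝ :=
  (ψ.multiplier : ℝ) * min (θ.budget : ℝ) (θ.setValue S) + ∑ j ∈ S, ψ.w j

namespace Instance

variable {n m : ℕ} (I : Instance n m)

/-- Total virtual welfare of an allocation at a profile. -/
def virtualWelfare (f : VirtualMap n m) (t : I.Profile) (x : Allocation n m) : ℝ :=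
  ∑ i, virtualValuation (t i).1 (f i (t i).1) (bundle x i)

/-- The allocation `x` maximizes the total virtual welfare at the profile `t`. -/
def MaximizesVirtualWelfare (f : VirtualMap n m) (t : I.Profile) (x : Allocation n m) : Prop :=
  ∀ y : Allocation n m, I.virtualWelfare f t y ≤ I.virtualWelfare f t x

theorem exists_maximizesVirtualWelfare (f : VirtualMap n m) (t : I.Profile) :
    ∃ x, I.MaximizesVirtualWelfare f t x :=
  Finite.exists_max (I.virtualWelfare f t)

/-- The price that goes with a virtual welfare maximizer: the minimum of budget and value if the
multiplier is positive, and `0` if the multiplier is `0`. -/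
def virtualPrice (f : VirtualMap n m) (t : I.Profile) (x : Allocation n m) (i : Fin n) : ℝ :=
  if 0 < (f i (t i).1).multiplier then
    min ((t i).1.budget : ℝ) ((t i).1.setValue (bundle x i))
  else 0

/-- The mechanism that draws `δ` from `Δ`, uses the mappings `f δ`, chooses the
allocation `a δ t` at the reported profile `t`, and charges the corresponding prices. If every
`a δ t` maximizes virtual welfare, it is a distribution over virtual welfare maximizers, and `a`
is its tie-breaking rule. -/
def samplingMechanism {K : ℕ} (Δ : PMF (Fin K)) (f : Fin K → VirtualMap n m)
    (a : Fin K → I.Profile → Allocation n m) : I.Mechanism where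
  Seed := Fin K
  seedLaw := Δ.toMeasure
  alloc t δ := a δ t
  price t δ := I.virtualPrice (f δ) t (a δ t)
  measurable_alloc _ _ _ := MeasurableSet.of_discrete
  measurable_price _ _ := Measurable.of_discrete

end Instance

end BudgetedAuction

end

/-! BIC and, for integrable prices, revenue depend on a mechanism only through its reduced form, the
vector of all `π_ij(s)` and `p_i(s)`. Ex-post IR, budgets and non-negative prices confine this
vector to a polytope, the hull of the finitely many `deterministicForms`
(`reducedForm_mem_convexHull`, `reduced_mem`).

A vertex of the polytope is the unique maximizer of some linear objective `c` among the
deterministic forms. Such an objective splits over profiles; the best price is zero or full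
according to the sign of its coefficient, and the allocation then maximizes a weighted sum of
scores. The weight `othersProb i` is `profileProb` divided by `prob i`, so rescaling each type's
coefficients by the inverse of its probability gives virtual welfare. Uniqueness of the maximizer
makes ties harmless (`exists_virtualMap_of_extremePoint`).

Every point of the polytope is a mixture of vertices (`exists_sampling`), in particular the reduced
form of an optimal mechanism. An optimum exists because revenue is linear on a compact set, the BIC
part of the polytope. -/

noncomputable section

namespace BudgetedAuction

/-! ### Separation, vertices and mixtures in finite dimension -/

section Convexity

variable {ι : Type*}

/-- Strict separation of a point from a closed convex set, in coordinates. -/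
theorem exists_sum_mul_lt [Fintype ι] {s : Set (ι → ℝ)} (hs : Convex ℝ s) (hc : IsClosed s) {x : ι → ℝ}
    (hx : x ∉ s) : ∃ c : ι → ℝ, ∀ a ∈ s, ∑ k, c k * a k < ∑ k, c k * x k := by
  classical
  obtain ⟨l, u, hl, hu⟩ := geometric_hahn_banach_closed_point hs hc hx
  have key : ∀ a : ι → ℝ, ∑ k, l (fun j => if k = j then 1 else 0) * a k = l a := by
    intro a
    have := LinearMap.pi_apply_eq_sum_univ (l : (ι → ℝ) →ₗ[ℝ] ℝ) a
    simp only [ContinuousLinearMap.coe_coe, smul_eq_mul] at this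
    rw [this]
    exact Finset.sum_congr rfl fun k _ => mul_comm _ _
  refine ⟨fun k => l (fun j => if k = j then 1 else 0), fun a ha => ?_⟩
  rw [key, key]
  exact (hl a ha).trans hu

/-- A vertex of the convex hull of a finite set is strictly exposed. -/
theorem exists_exposing [Fintype ι] {A : Set (ι → ℝ)} (hA : A.Finite) {v : ι → ℝ}
    (hv : v ∈ (convexHull ℝ A).extremePoints ℝ) :
    ∃ c : ι → ℝ, ∀ a ∈ A, a ≠ v → ∑ k, c k * a k < ∑ k, c k * v k := by
  -- An extreme point is not in the hull of the other points of the polytope, let alone of the other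
  -- generators.
  have hv' : v ∉ convexHull ℝ (A \ {v}) := fun h =>
    (((convex_convexHull ℝ A).mem_extremePoints_iff_mem_sdiff_convexHull_sdiff).1 hv).2
      (convexHull_mono (Set.sdiff_subset_sdiff_left (subset_convexHull ℝ A)) h)
  obtain ⟨c, hc⟩ := exists_sum_mul_lt (convex_convexHull ℝ _)
    ((hA.subset Set.sdiff_subset).isClosed_convexHull ℝ) hv'
  exact ⟨c, fun a ha hav => hc a (subset_convexHull ℝ _ ⟨ha, hav⟩)⟩

theorem convexHull_extremePoints_of_finite [Finite ι] {A : Set (ι → ℝ)} (hA : A.Finite) :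
    convexHull ℝ ((convexHull ℝ A).extremePoints ℝ) = convexHull ℝ A := by
  have h := closure_convexHull_extremePoints (hA.isCompact_convexHull ℝ) (convex_convexHull ℝ A)
  rwa [IsClosed.closure_eq] at h
  exact (hA.subset extremePoints_convexHull_subset).isClosed_convexHull ℝ

/-- A point of a convex hull is the mean of a finitely supported distribution. -/
theorem exists_pmf_of_mem_convexHull {A : Set (ι → ℝ)} {x : ι → ℝ} (hx : x ∈ convexHull ℝ A) :
    ∃ (K : ℕ) (Δ : PMF (Fin K)) (z : Fin K → ι → ℝ),
      (∀ δ, z δ ∈ A) ∧ ∑ δ, (Δ δ).toReal • z δ = x := by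
  obtain ⟨κ, _, w, z, hw, hsum, hz, rfl⟩ := mem_convexHull_iff_exists_fintype.1 hx
  let e := (Fintype.equivFin κ).symm
  have h1 : ∑ δ, ENNReal.ofReal (w (e δ)) = 1 := by
    rw [← ENNReal.ofReal_sum_of_nonneg fun δ _ => hw _, e.sum_comp w, hsum, ENNReal.ofReal_one]
  refine ⟨Fintype.card κ, PMF.ofFintype (fun δ => ENNReal.ofReal (w (e δ))) h1,
    fun δ => z (e δ), fun δ => hz _, ?_⟩
  simp only [PMF.ofFintype_apply, ENNReal.toReal_ofReal (hw _)]
  exact e.sum_comp fun k => w k • z k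

end Convexity

/-! ### The polytope of reduced forms -/

/-- The allocation indicators of a bidder, at `some j`, together with her price, at `none`. -/
def outcome {n m : ℕ} (x : Allocation n m) (q : Fin n → ℝ) (i : Fin n) : Option (Fin m) → ℝ
  | some j => if x j = some i then 1 else 0
  | none => q i

namespace Instance

variable {n m : ℕ} (I : Instance n m)

/-- The coordinates of a reduced form: a bidder, a type of hers, and an item or `none`
for the price. -/
abbrev ReducedIndex := (i : Fin n) × (I.types i × Option (Fin m))

open Classical in
/-- The reduced form induced by ex-post quantities. -/
def reducedForm (y : I.Profile → Fin n → Option (Fin m) → ℝ) (k : I.ReducedIndex) : ℝ :=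
  ∑ t : I.Profile, if t k.1 = k.2.1 then I.othersProb k.1 t * y t k.1 k.2.2 else 0

/-- Without interim constraints a linear objective can thus be maximized separately at each profile.
-/
theorem sum_mul_reducedForm (c : I.ReducedIndex → ℝ)
    (y : I.Profile → Fin n → Option (Fin m) → ℝ) :
    ∑ k, c k * I.reducedForm y k =
      ∑ t : I.Profile, ∑ i, I.othersProb i t * ∑ o, c ⟨i, t i, o⟩ * y t i o := by
  classical
  simp only [reducedForm, Fintype.sum_sigma, Fintype.sum_prod_type, Finset.mul_sum]
  rw [Finset.sum_comm (s := (univ : Finset I.Profile))]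
  refine Finset.sum_congr rfl fun i _ => ?_
  have hswap : ∀ F : I.types i → Option (Fin m) → I.Profile → ℝ,
      ∑ s, ∑ o, ∑ t, F s o t = ∑ t, ∑ s, ∑ o, F s o t := fun F => by
    rw [Finset.sum_comm (s := (univ : Finset I.Profile))]
    exact Finset.sum_congr rfl fun s _ => Finset.sum_comm
  rw [hswap]
  refine Finset.sum_congr rfl fun t _ => ?_
  rw [Finset.sum_eq_single (t i) (fun s _ hs => by simp [hs.symm]) (by simp)]
  exact Finset.sum_congr rfl fun o _ => by rw [if_pos rfl, mul_left_comm]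

/-- The largest price that is individually rational and within the budget. -/
def fullPrice (t : I.Profile) (x : Allocation n m) (i : Fin n) : ℝ :=
  min ((t i).1.budget : ℝ) ((t i).1.setValue (bundle x i))

theorem fullPrice_nonneg (t : I.Profile) (x : Allocation n m) (i : Fin n) :
    0 ≤ I.fullPrice t x i :=
  le_min (NNReal.coe_nonneg _) (Finset.sum_nonneg fun _ _ => NNReal.coe_nonneg _)

/-- The value of a bidder's part of the objective `c`, when the price is chosen best. -/
def score (c : I.ReducedIndex → ℝ) (t : I.Profile) (x : Allocation n m) (i : Fin n) : ℝ :=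
  max (c ⟨i, t i, none⟩) 0 * I.fullPrice t x i + ∑ j ∈ bundle x i, c ⟨i, t i, some j⟩

theorem sum_mul_outcome (c : I.ReducedIndex → ℝ) (t : I.Profile) (x : Allocation n m)
    (q : Fin n → ℝ) (i : Fin n) :
    ∑ o, c ⟨i, t i, o⟩ * outcome x q i o =
      c ⟨i, t i, none⟩ * q i + ∑ j ∈ bundle x i, c ⟨i, t i, some j⟩ := by
  simp [Fintype.sum_option, outcome, bundle, Finset.sum_filter]

/-- The objective is linear in the price on `[0, fullPrice]`, so an endpoint is best; this is where
the non-negative multiplier `max c 0` comes from. -/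
theorem sum_mul_outcome_le_score (c : I.ReducedIndex → ℝ) (t : I.Profile) (x : Allocation n m)
    {q : Fin n → ℝ} {i : Fin n} (h0 : 0 ≤ q i) (h1 : q i ≤ I.fullPrice t x i) :
    ∑ o, c ⟨i, t i, o⟩ * outcome x q i o ≤ I.score c t x i := by
  rw [sum_mul_outcome, score]
  refine add_le_add_left ?_ _
  exact (mul_le_mul_of_nonneg_right (le_max_left _ 0) h0).trans
    (mul_le_mul_of_nonneg_left h1 (le_max_right _ _))

theorem sum_mul_outcome_eq_score (c : I.ReducedIndex → ℝ) (t : I.Profile) (x : Allocation n m)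
    {q : Fin n → ℝ} {i : Fin n}
    (hq : q i = if 0 < c ⟨i, t i, none⟩ then I.fullPrice t x i else 0) :
    ∑ o, c ⟨i, t i, o⟩ * outcome x q i o = I.score c t x i := by
  rw [sum_mul_outcome, score, hq]
  split_ifs with h
  · rw [max_eq_left h.le]
  · rw [max_eq_right (not_lt.1 h)]; simp

theorem othersProb_nonneg (i : Fin n) (t : I.Profile) : 0 ≤ I.othersProb i t :=
  Finset.prod_nonneg fun _ _ => ENNReal.toReal_nonneg

open Classical in
/-- The reduced forms of deterministic mechanisms in which everyone pays either nothing or the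
full price. -/
def deterministicForms : Set (I.ReducedIndex → ℝ) :=
  Set.range fun p : I.Profile → Allocation n m × (Fin n → Prop) =>
    I.reducedForm fun t => outcome (p t).1
      fun i => if (p t).2 i then I.fullPrice t (p t).1 i else 0

theorem finite_deterministicForms : I.deterministicForms.Finite := Set.finite_range _

/-- Deterministic outcomes with individually rational prices within the budgets have their
reduced form in the polytope spanned by `deterministicForms`. -/
theorem reducedForm_mem_convexHull (x : I.Profile → Allocation n m) (q : I.Profile → Fin n → ℝ)
    (h0 : ∀ t i, 0 ≤ q t i) (h1 : ∀ t i, q t i ≤ I.fullPrice t (x t) i) :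
    I.reducedForm (fun t => outcome (x t) (q t)) ∈ convexHull ℝ I.deterministicForms := by
  classical
  by_contra h
  obtain ⟨c, hc⟩ := exists_sum_mul_lt (convex_convexHull ℝ _)
    (I.finite_deterministicForms.isClosed_convexHull ℝ) h
  -- The competitor keeps the allocations and charges the full price exactly where the separating
  -- functional rewards payment.
  refine (hc _ (subset_convexHull ℝ _
    ⟨fun t => (x t, fun i => 0 < c ⟨i, t i, none⟩), rfl⟩)).not_ge ?_
  simp only [sum_mul_reducedForm]
  refine Finset.sum_le_sum fun t _ => Finset.sum_le_sum fun i _ =>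
    mul_le_mul_of_nonneg_left ?_ (I.othersProb_nonneg i t)
  rw [I.sum_mul_outcome_eq_score c t (x t)
    (q := fun i => if 0 < c ⟨i, t i, none⟩ then I.fullPrice t (x t) i else 0) (i := i) rfl]
  exact I.sum_mul_outcome_le_score c t (x t) (h0 t i) (h1 t i)

/-! ### Linear objectives as virtual welfare -/

/-- The factor by which the objective is rescaled at a type; types of probability zero get
the factor `L`. -/
def scale (L : ℝ) (i : Fin n) (s : I.types i) : ℝ :=
  if I.prob i s = 0 then L else (I.prob i s)⁻¹

theorem prob_nonneg (i : Fin n) (s : I.types i) : 0 ≤ I.prob i s := ENNReal.toReal_nonneg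

theorem scale_pos {L : ℝ} (hL : 0 < L) (i : Fin n) (s : I.types i) : 0 < I.scale L i s := by
  unfold scale
  split_ifs with h
  · exact hL
  · exact inv_pos.2 ((I.prob_nonneg i s).lt_of_ne' h)

open Classical in
/-- The virtual types that encode the objective `c`. -/
def encodingMap (c : I.ReducedIndex → ℝ) (L : ℝ) : VirtualMap n m := fun i θ =>
  if h : θ ∈ I.types i then
    { multiplier := (I.scale L i ⟨θ, h⟩ * c ⟨i, ⟨θ, h⟩, none⟩).toNNReal
      w := fun j => I.scale L i ⟨θ, h⟩ * c ⟨i, ⟨θ, h⟩, some j⟩ }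
  else ⟨0, 0⟩

theorem virtualWelfare_encodingMap (c : I.ReducedIndex → ℝ) {L : ℝ} (hL : 0 < L) (t : I.Profile)
    (x : Allocation n m) :
    I.virtualWelfare (I.encodingMap c L) t x = ∑ i, I.scale L i (t i) * I.score c t x i := by
  refine Finset.sum_congr rfl fun i _ => ?_
  have hp := (I.scale_pos hL i (t i)).le
  simp only [virtualValuation, encodingMap, (t i).2, dif_pos, Subtype.coe_eta, score, fullPrice,
    Real.coe_toNNReal', mul_add, ← Finset.mul_sum]
  rw [← mul_assoc, mul_max_of_nonneg _ _ hp, mul_zero]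

theorem virtualPrice_encodingMap (c : I.ReducedIndex → ℝ) {L : ℝ} (hL : 0 < L) (t : I.Profile)
    (x : Allocation n m) (i : Fin n) :
    I.virtualPrice (I.encodingMap c L) t x i =
      if 0 < c ⟨i, t i, none⟩ then I.fullPrice t x i else 0 := by
  have hp := I.scale_pos hL i (t i)
  simp only [virtualPrice, encodingMap, (t i).2, dif_pos, Subtype.coe_eta, Real.toNNReal_pos,
    mul_pos_iff_of_pos_left hp, fullPrice]

/-- At a profile containing a zero-probability type of bidder `i`, only her own term of the
objective can survive. -/
theorem othersProb_eq_zero {t : I.Profile} {i k : Fin n} (hi : I.prob i (t i) = 0) (hk : k ≠ i) :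
    I.othersProb k t = 0 :=
  Finset.prod_eq_zero (Finset.mem_erase.2 ⟨hk.symm, Finset.mem_univ i⟩) hi

theorem prob_mul_othersProb (i : Fin n) (t : I.Profile) :
    I.prob i (t i) * I.othersProb i t = I.profileProb t :=
  Finset.mul_prod_erase univ (fun k => I.prob k (t k)) (Finset.mem_univ i)

/-- If zero-probability types get a large enough factor, virtual welfare maximizers maximize
the objective `c` profile by profile. -/
theorem exists_maximizes_imp (c : I.ReducedIndex → ℝ) :
    ∃ L : ℝ, 0 < L ∧ ∀ t x, I.MaximizesVirtualWelfare (I.encodingMap c L) t x →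
      ∀ y, ∑ i, I.othersProb i t * I.score c t y i ≤ ∑ i, I.othersProb i t * I.score c t x i := by
  have main : ∀ (t : I.Profile) (x y : Allocation n m), ∀ᶠ L : ℝ in Filter.atTop,
      ∑ i, I.scale L i (t i) * I.score c t y i ≤ ∑ i, I.scale L i (t i) * I.score c t x i →
      ∑ i, I.othersProb i t * I.score c t y i ≤ ∑ i, I.othersProb i t * I.score c t x i := by
    intro t x y
    by_cases hz : ∃ i, I.prob i (t i) = 0
    · obtain ⟨i, hi⟩ := hz
      have hG : ∀ z, ∑ k, I.othersProb k t * I.score c t z k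
          = I.othersProb i t * I.score c t z i := fun z =>
        Finset.sum_eq_single i (fun k _ hk => by rw [I.othersProb_eq_zero hi hk, zero_mul])
          (by simp)
      simp only [hG]
      -- If a second bidder also has a zero-probability type, the objective vanishes at this
      -- profile.
      by_cases ho : I.othersProb i t = 0
      · simp [ho]
      rcases le_or_gt (I.score c t y i) (I.score c t x i) with hle | hlt
      · exact Filter.Eventually.of_forall fun _ _ =>
          mul_le_mul_of_nonneg_left hle (I.othersProb_nonneg i t)
      have hk : ∀ k ∈ univ.erase i, I.prob k (t k) ≠ 0 := fun k hk h => ho <|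
        Finset.prod_eq_zero hk h
      have hW : ∀ (L : ℝ) z, ∑ k, I.scale L k (t k) * I.score c t z k = L * I.score c t z i +
          ∑ k ∈ univ.erase i, (I.prob k (t k))⁻¹ * I.score c t z k := by
        intro L z
        rw [← Finset.add_sum_erase univ _ (Finset.mem_univ i)]
        congr 1
        · rw [scale, if_pos hi]
        · exact Finset.sum_congr rfl fun k hk' => by rw [scale, if_neg (hk k hk')]
      simp only [hW]
      set B := fun z => ∑ k ∈ univ.erase i, (I.prob k (t k))⁻¹ * I.score c t z k
      -- Beyond this threshold the gap in bidder `i`'s score outweighs all other terms, so `y` would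
      -- have strictly larger virtual welfare than `x`.
      filter_upwards [Filter.eventually_gt_atTop
        ((B x - B y) / (I.score c t y i - I.score c t x i))] with L hL hcon
      rw [div_lt_iff₀ (sub_pos.2 hlt)] at hL
      simp only [B] at hL
      linarith
    · push Not at hz
      -- With all probabilities positive, the objective is virtual welfare times `profileProb t`.
      have hG : ∀ (L : ℝ) z, ∑ k, I.othersProb k t * I.score c t z k
          = I.profileProb t * ∑ k, I.scale L k (t k) * I.score c t z k := by
        intro L z
        rw [Finset.mul_sum]
        refine Finset.sum_congr rfl fun k _ => ?_
        rw [← I.prob_mul_othersProb k t, scale, if_neg (hz k)]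
        field_simp [hz k]
      refine Filter.Eventually.of_forall fun L h => ?_
      rw [hG L, hG L]
      exact mul_le_mul_of_nonneg_left h (Finset.prod_nonneg fun _ _ => I.prob_nonneg _ _)
  have hall : ∀ᶠ L : ℝ in Filter.atTop, ∀ (t : I.Profile) (x y : Allocation n m),
      ∑ i, I.scale L i (t i) * I.score c t y i ≤ ∑ i, I.scale L i (t i) * I.score c t x i →
      ∑ i, I.othersProb i t * I.score c t y i ≤ ∑ i, I.othersProb i t * I.score c t x i := by
    -- Profiles and allocations are finite in number, so one `L` serves them all.
    simpa only [Filter.eventually_all] using main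
  obtain ⟨L, hL, h0⟩ := (hall.and (Filter.eventually_gt_atTop 0)).exists
  refine ⟨L, h0, fun t x hx y => hL t x y ?_⟩
  simpa only [I.virtualWelfare_encodingMap c h0] using hx y

/-- Every vertex of the polytope of reduced forms is the reduced form of a virtual welfare
maximizer, however ties are broken. -/
theorem exists_virtualMap_of_extremePoint {v : I.ReducedIndex → ℝ}
    (hv : v ∈ (convexHull ℝ I.deterministicForms).extremePoints ℝ) :
    ∃ f : VirtualMap n m, ∀ a : I.Profile → Allocation n m,
      (∀ t, I.MaximizesVirtualWelfare f t (a t)) →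
        I.reducedForm (fun t => outcome (a t) (I.virtualPrice f t (a t))) = v := by
  classical
  obtain ⟨c, hc⟩ := exists_exposing I.finite_deterministicForms hv
  obtain ⟨L, hL, hmax⟩ := I.exists_maximizes_imp c
  refine ⟨I.encodingMap c L, fun a ha => by_contra fun hne => ?_⟩
  -- Exposure is strict only against `deterministicForms`, so the maximizer's form must be shown to
  -- be one of them.
  have hmem : I.reducedForm (fun t => outcome (a t) (I.virtualPrice (I.encodingMap c L) t (a t)))
      ∈ I.deterministicForms := by
    refine ⟨fun t => (a t, fun i => 0 < c ⟨i, t i, none⟩), ?_⟩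
    refine congrArg I.reducedForm (funext fun t => congrArg (outcome (a t)) (funext fun i => ?_))
    rw [I.virtualPrice_encodingMap c hL]
  refine (hc _ hmem hne).not_ge ?_
  obtain ⟨p, rfl⟩ := extremePoints_convexHull_subset hv
  simp only [sum_mul_reducedForm]
  refine Finset.sum_le_sum fun t _ => ?_
  calc _ ≤ ∑ i, I.othersProb i t * I.score c t (p t).1 i := by
        refine Finset.sum_le_sum fun i _ =>
          mul_le_mul_of_nonneg_left ?_ (I.othersProb_nonneg i t)
        have := I.fullPrice_nonneg t (p t).1 i
        apply I.sum_mul_outcome_le_score <;> split_ifs <;> first | exact le_rfl | exact this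
    _ ≤ ∑ i, I.othersProb i t * I.score c t (a t) i := hmax t (a t) (ha t) _
    _ = _ := Finset.sum_congr rfl fun i _ => by
        rw [I.sum_mul_outcome_eq_score c t (a t) (I.virtualPrice_encodingMap c hL t (a t) i)]

/-! ### Reduced forms of randomized mechanisms -/

namespace Mechanism

variable {I} (M : I.Mechanism)

/-- The interim allocation probabilities and prices as one vector. -/
def reduced (k : I.ReducedIndex) : ℝ :=
  match k with
  | ⟨i, s, some j⟩ => M.interimAlloc i j s
  | ⟨i, s, none⟩ => M.interimPrice i s

theorem outcome_integral (hint : ∀ t i, Integrable (fun r => M.price t r i) M.seedLaw)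
    (t : I.Profile) (i : Fin n) (o : Option (Fin m)) :
    Integrable (fun r => outcome (M.alloc t r) (M.price t r) i o) M.seedLaw ∧
    ∫ r, outcome (M.alloc t r) (M.price t r) i o ∂M.seedLaw =
      match o with
      | some j => M.seedLaw.real {r | M.alloc t r j = some i}
      | none => ∫ r, M.price t r i ∂M.seedLaw := by
  cases o with
  | none => exact ⟨hint t i, rfl⟩
  | some j =>
    have h : (fun r => outcome (M.alloc t r) (M.price t r) i (some j)) =
        {r | M.alloc t r j = some i}.indicator 1 := by
      classical
      funext r
      simp [outcome, Set.indicator_apply]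
    rw [h]
    exact ⟨(integrable_const 1).indicator (M.measurable_alloc t i j),
      integral_indicator_one (M.measurable_alloc t i j)⟩

/-- Fixing the seed leaves a deterministic mechanism; as a mean of such forms, `reduced` stays in
any closed convex set containing them. -/
theorem reduced_eq_integral (hint : ∀ t i, Integrable (fun r => M.price t r i) M.seedLaw) :
    Integrable (fun r => I.reducedForm fun t => outcome (M.alloc t r) (M.price t r)) M.seedLaw ∧
    M.reduced =
      ∫ r, I.reducedForm (fun t => outcome (M.alloc t r) (M.price t r)) ∂M.seedLaw := by
  classical
  have hk : ∀ (k : I.ReducedIndex) (t : I.Profile), Integrable (fun r =>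
      if t k.1 = k.2.1 then I.othersProb k.1 t * outcome (M.alloc t r) (M.price t r) k.1 k.2.2
      else 0) M.seedLaw := by
    intro k t
    split_ifs
    · exact (M.outcome_integral hint t k.1 k.2.2).1.const_mul _
    · exact integrable_zero _ _ _
  have hred : ∀ k : I.ReducedIndex, Integrable
      (fun r => I.reducedForm (fun t => outcome (M.alloc t r) (M.price t r)) k) M.seedLaw :=
    fun k => integrable_finsetSum _ fun t _ => hk k t
  refine ⟨Integrable.of_eval hred, ?_⟩
  funext k
  rw [eval_integral hred]
  simp only [reducedForm]
  rw [integral_finsetSum _ fun t _ => hk k t]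
  obtain ⟨i, s, o⟩ := k
  have hterm : ∀ t : I.Profile, (∫ r, if t i = s then
      I.othersProb i t * outcome (M.alloc t r) (M.price t r) i o else 0 ∂M.seedLaw) =
      if t i = s then I.othersProb i t * ∫ r, outcome (M.alloc t r) (M.price t r) i o ∂M.seedLaw
      else 0 := by
    intro t
    split_ifs
    · exact integral_const_mul _ _
    · exact integral_zero _ _
  simp only [hterm, (M.outcome_integral hint _ i o).2]
  cases o <;> simp only [reduced, interimAlloc, interimPrice]

theorem integrable_price (hB : M.RespectsBudgets) (hN : M.NoPositiveTransfers)
    (t : I.Profile) (i : Fin n) : Integrable (fun r => M.price t r i) M.seedLaw := by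
  refine Integrable.of_bound (C := ((t i).1.budget : ℝ))
    (M.measurable_price t i).aestronglyMeasurable (Filter.Eventually.of_forall fun r => ?_)
  rw [Real.norm_of_nonneg (hN t r i)]
  exact hB t r i

theorem reduced_mem (hIR : M.ExPostIR) (hB : M.RespectsBudgets) (hN : M.NoPositiveTransfers) :
    M.reduced ∈ convexHull ℝ I.deterministicForms := by
  obtain ⟨h1, h2⟩ := M.reduced_eq_integral (M.integrable_price hB hN)
  rw [h2]
  exact (convex_convexHull ℝ _).integral_mem (I.finite_deterministicForms.isClosed_convexHull ℝ)
    (Filter.Eventually.of_forall fun r => I.reducedForm_mem_convexHull _ _ (fun t i => hN t r i)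
      fun t i => le_min (hB t r i) (hIR t r i)) h1

theorem revenue_eq (hint : ∀ t i, Integrable (fun r => M.price t r i) M.seedLaw) :
    M.revenue = ∑ i, ∑ s, I.prob i s * M.reduced ⟨i, s, none⟩ := by
  classical
  simp only [revenue, reduced, interimPrice]
  have h1 : ∀ t : I.Profile, I.profileProb t * ∫ r, ∑ i, M.price t r i ∂M.seedLaw =
      ∑ i, I.profileProb t * ∫ r, M.price t r i ∂M.seedLaw := fun t => by
    rw [integral_finsetSum _ fun i _ => hint t i, Finset.mul_sum]
  simp only [h1]
  rw [Finset.sum_comm]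
  refine Finset.sum_congr rfl fun i _ => ?_
  simp only [Finset.mul_sum]
  rw [Finset.sum_comm]
  refine Finset.sum_congr rfl fun t _ => ?_
  rw [Finset.sum_eq_single (t i) (fun s _ hs => by simp [hs.symm]) (by simp), if_pos rfl,
    ← mul_assoc, I.prob_mul_othersProb]

end Mechanism

/-! ### Implementation and existence of an optimum -/

/-- Every point of the polytope of reduced forms is implemented by a distribution over virtual
welfare maximizers, however ties are broken. -/
theorem exists_sampling {x : I.ReducedIndex → ℝ}
    (hx : x ∈ convexHull ℝ I.deterministicForms) :
    ∃ (K : ℕ) (Δ : PMF (Fin K)) (f : Fin K → VirtualMap n m),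
      ∀ a : Fin K → I.Profile → Allocation n m,
        (∀ δ t, I.MaximizesVirtualWelfare (f δ) t (a δ t)) →
          (I.samplingMechanism Δ f a).reduced = x := by
  rw [← convexHull_extremePoints_of_finite I.finite_deterministicForms] at hx
  obtain ⟨K, Δ, z, hz, rfl⟩ := exists_pmf_of_mem_convexHull hx
  choose f hf using fun δ => I.exists_virtualMap_of_extremePoint (hz δ)
  refine ⟨K, Δ, f, fun a ha => ?_⟩
  rw [((I.samplingMechanism Δ f a).reduced_eq_integral fun t i => ?_).2]
  · change ∫ δ : Fin K, _ ∂Δ.toMeasure = _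
    rw [PMF.integral_eq_sum]
    exact Finset.sum_congr rfl fun δ _ => congrArg _ (hf δ (a δ) (ha δ))
  · change Integrable _ Δ.toMeasure
    exact Integrable.of_finite

theorem virtualPrice_nonneg (f : VirtualMap n m) (t : I.Profile) (x : Allocation n m)
    (i : Fin n) : 0 ≤ I.virtualPrice f t x i := by
  unfold virtualPrice
  split_ifs
  exacts [I.fullPrice_nonneg t x i, le_rfl]

theorem virtualPrice_le (f : VirtualMap n m) (t : I.Profile) (x : Allocation n m)
    (i : Fin n) : I.virtualPrice f t x i ≤ I.fullPrice t x i := by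
  unfold virtualPrice
  split_ifs
  exacts [le_rfl, I.fullPrice_nonneg t x i]

/-- Incentive compatibility of a reduced form. -/
def ReducedBIC (x : I.ReducedIndex → ℝ) : Prop :=
  ∀ (i : Fin n) (s s' : I.types i),
    ∑ j, (s.1.value j : ℝ) * x ⟨i, s', some j⟩ - x ⟨i, s', none⟩ ≤
      ∑ j, (s.1.value j : ℝ) * x ⟨i, s, some j⟩ - x ⟨i, s, none⟩

/-- The ex-post constraints hold for any `f` and `a`, since prices are zero or full; only BIC needs
the reduced form. -/
theorem samplingMechanism_admissible {K : ℕ} (Δ : PMF (Fin K)) (f : Fin K → VirtualMap n m)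
    (a : Fin K → I.Profile → Allocation n m)
    (h : I.ReducedBIC (I.samplingMechanism Δ f a).reduced) :
    (I.samplingMechanism Δ f a).Admissible :=
  ⟨h, fun t δ i => (I.virtualPrice_le (f δ) t (a δ t) i).trans (min_le_right _ _),
    fun t δ i => (I.virtualPrice_le (f δ) t (a δ t) i).trans (min_le_left _ _),
    fun t δ i => I.virtualPrice_nonneg (f δ) t (a δ t) i⟩

namespace Mechanism

variable {I}

theorem Admissible.revenue_eq {M : I.Mechanism} (hM : M.Admissible) :
    M.revenue = ∑ i, ∑ s, I.prob i s * M.reduced ⟨i, s, none⟩ :=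
  Mechanism.revenue_eq M (M.integrable_price hM.2.2.1 hM.2.2.2)

theorem Admissible.reduced_mem {M : I.Mechanism} (hM : M.Admissible) :
    M.reduced ∈ convexHull ℝ I.deterministicForms :=
  Mechanism.reduced_mem M hM.2.1 hM.2.2.1 hM.2.2.2

end Mechanism

theorem isClosed_reducedBIC : IsClosed {x | I.ReducedBIC x} := by
  simp only [ReducedBIC, Set.ofPred_forall]
  refine isClosed_iInter fun i => isClosed_iInter fun s => isClosed_iInter fun s' =>
    isClosed_le (by fun_prop) (by fun_prop)

theorem exists_isOptimal : ∃ M : I.Mechanism, M.IsOptimal := by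
  -- Selling nothing for nothing shows that the feasible set is nonempty.
  have hz : (0 : I.ReducedIndex → ℝ) ∈ convexHull ℝ I.deterministicForms := by
    have := I.reducedForm_mem_convexHull (fun _ _ => none) (fun _ _ => 0) (fun _ _ => le_rfl)
      fun t i => I.fullPrice_nonneg t _ i
    convert this using 1
    funext ⟨i, s, o⟩
    cases o <;> simp [reducedForm, outcome]
  obtain ⟨x, ⟨hx, hBIC⟩, hmax⟩ := ((I.finite_deterministicForms.isCompact_convexHull ℝ).inter_right
    I.isClosed_reducedBIC).exists_isMaxOn ⟨0, hz, fun i s s' => by simp⟩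
    (f := fun x => ∑ i, ∑ s, I.prob i s * x ⟨i, s, none⟩) (by fun_prop)
  obtain ⟨K, Δ, f, h⟩ := I.exists_sampling hx
  choose a ha using fun δ t => I.exists_maximizesVirtualWelfare (f δ) t
  have hred := h a ha
  have hadm := I.samplingMechanism_admissible Δ f a (hred.symm ▸ hBIC)
  refine ⟨_, hadm, fun M hM => ?_⟩
  rw [hM.revenue_eq, hadm.revenue_eq, hred]
  exact hmax ⟨hM.reduced_mem, hM.1⟩

end Instance

end BudgetedAuction

end

theorem theorem3p4 (n m : ℕ) (I : BudgetedAuction.Instance n m) :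
    (∃ M : I.Mechanism, M.IsOptimal) ∧
    ∀ M : I.Mechanism, M.IsOptimal →
      ∃ (K : ℕ) (Δ : PMF (Fin K)) (f : Fin K → BudgetedAuction.VirtualMap n m),
        ∀ a : Fin K → I.Profile → BudgetedAuction.Allocation n m,
          (∀ δ t, I.MaximizesVirtualWelfare (f δ) t (a δ t)) →
            (I.samplingMechanism Δ f a).IsOptimal ∧
            (∀ i j s, (I.samplingMechanism Δ f a).interimAlloc i j s = M.interimAlloc i j s) ∧
            (∀ i s, (I.samplingMechanism Δ f a).interimPrice i s = M.interimPrice i s) := by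
  refine ⟨I.exists_isOptimal, fun M hM => ?_⟩
  obtain ⟨K, Δ, f, h⟩ := I.exists_sampling hM.1.reduced_mem
  refine ⟨K, Δ, f, fun a ha => ?_⟩
  have hred := h a ha
  have hadm := I.samplingMechanism_admissible Δ f a (hred.symm ▸ hM.1.1)
  refine ⟨⟨hadm, fun M' hM' => (hM.2 M' hM').trans_eq ?_⟩,
    fun i j s => congrFun hred ⟨i, s, some j⟩, fun i s => congrFun hred ⟨i, s, none⟩⟩
  rw [hM.1.revenue_eq, hadm.revenue_eq, hred]
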